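/- All Hilbert spaces are finite-dimensional, $d_S$ denotes the dimension of a system $S$, logarithms are to base 2, and a quantum operation is a completely positive trace-preserving (CPTP) map, i.e. a map $\rho\mapsto\sum_k E_k\rho E_k^\dagger$ with $\sum_k E_k^\dagger E_k=\mathsf{id}$. The conditional min-entropy of a state $\rho_{AB}$ is $$H_{\min}(A|B)_\rho=-\inf_{\sigma_B}\ \inf\{\lambda\in\mathbb{R}:\rho_{AB}\le 2^{\lambda}\,\mathsf{id}_A\otimes\sigma_B\},$$ with $\sigma_B$ ranging over the density operators on $B$ (and $\inf\emptyset=+\infty$). Fix an orthonormal basis $\{|a\rangle\}$ of $A_0$. A cq-state with $A_0$ classical is a state $\sum_a p_a|a\rangle\langle a|\otimes\rho^a$ with $p$ a probability distribution and $\rho^a$ density operators. A quantum operation $\Gamma:L(A_0\otimes S)\to L(A_0\otimes S')$ is classically controlled by $A_0$ if there are CPTP maps $\Gamma^a:L(S)\to L(S')$ such that $\Gamma(\sum_a p_a|a\rangle\langle a|\otimes\rho^a)=\sum_a p_a|a\rangle\langle a|\otimes\Gamma^a(\rho^a)$ for all cq-states. Let $r\ge 1$. An $(r,m_A,m_B)$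 two-party quantum protocol in which Alice's operations are classically controlled by $A_0$ consists of memory spaces $A_1,\dots,A_r$ (Alice) and $B_1,\dots,B_r$ (Bob), an input space $B_0$ for Bob, message spaces $X_1,\dots,X_r$ (Alice to Bob) and $Y_1,\dots,Y_{r-1}$ (Bob to Alice), quantum operations $\Phi_1:L(A_0)\to L(A_0\otimes A_1\otimes X_1)$ and $\Phi_i:L(A_0\otimes A_{i-1}\otimes Y_{i-1})\to L(A_0\otimes A_i\otimes X_i)$ for $2\le i\le r$, all classically controlled by $A_0$, and arbitrary quantum operations $\Psi_j:L(B_{j-1}\otimes X_j)\to L(B_j\otimes Y_j)$ for $1\le j\le r-1$ and $\Psi_r:L(B_{r-1}\otimes X_r)\to L(B_r)$; here $m_A=\sum_{i=1}^r\log d_{X_i}$ and $m_B=\sum_{j=1}^{r-1}\log d_{Y_j}$. The operations are applied in the order $\Phi_1,\Psi_1,\Phi_2,\Psi_2,\dots,\Phi_r,\Psi_r$, each tensored with the identity on the other systems. Theorem (interactive leakage chain rule for quantum min-entropy). Let $\rho_{A_0B_0}$ be a cq-state with $A_0$ classical, let such a protocol be run on $\rho_{A_0B_0}$, and let $\sigma_{A_0A_rB_r}$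 be the final state. Then $$H_{\min}(A_0|B_r)_\sigma\ \ge\ H_{\min}(A_0|B_0)_\rho-\min\{m_A+m_B,\ 2m_A\},$$ where $H_{\min}(A_0|B_r)_\sigma$ is evaluated on the reduced state $\sigma_{A_0B_r}=\mathrm{tr}_{A_r}\,\sigma_{A_0A_rB_r}$. -/

import Mathlib

open scoped Kronecker ComplexOrder

noncomputable section

namespace QLeak

/-- `L(α)`: linear operators on the finite-dimensional Hilbert space with orthonormal basis
`{|i⟩ : i ∈ α}`, written as matrices. The tensor product of two spaces has basis `α × β`. -/
abbrev Op (α : Type) : Type := Matrix α α ℂ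

/-- Density operators: positive semidefinite with unit trace. -/
def IsDensity {α : Type} [Fintype α] (ρ : Op α) : Prop :=
  ρ.PosSemidef ∧ ρ.trace = 1

/-- The projector `|a⟩⟨a|`. -/
def ketbra {α : Type} [DecidableEq α] (a : α) : Op α := Matrix.single a a 1

/-- Probability distributions on a finite set. -/
def IsProb {α : Type} [Fintype α] (p : α → ℝ) : Prop :=
  (∀ a, 0 ≤ p a) ∧ ∑ a, p a = 1

/-- Quantum operations (CPTP maps): `Φ(ρ) = ∑ₖ Eₖ ρ Eₖ†` with `∑ₖ Eₖ† Eₖ = id`. -/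
def IsCPTP {α β : Type} [Fintype α] [DecidableEq α] [Fintype β]
    (Φ : Op α →ₗ[ℂ] Op β) : Prop :=
  ∃ (m : ℕ) (E : Fin m → Matrix β α ℂ),
    (∑ k, (E k).conjTranspose * E k = 1) ∧
      ∀ ρ : Op α, Φ ρ = ∑ k, E k * ρ * (E k).conjTranspose

/-- The operator `∑ₐ pₐ |a⟩⟨a| ⊗ ρᵃ`. -/
def cqOp {α β : Type} [Fintype α] [DecidableEq α] (p : α → ℝ) (ρ : α → Op β) : Op (α × β) :=
  ∑ a, p a • (ketbra a ⊗ₖ ρ a)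

/-- cq-states on `α ⊗ β`, with `α` classical. -/
def IsCQState {α β : Type} [Fintype α] [DecidableEq α] [Fintype β] (ρ : Op (α × β)) : Prop :=
  ∃ (p : α → ℝ) (τ : α → Op β), IsProb p ∧ (∀ a, IsDensity (τ a)) ∧ ρ = cqOp p τ

/-- A quantum operation `Γ : L(α ⊗ β) → L(α ⊗ γ)` that is controlled by the classical system `α`:
on cq-states, `Γ (∑ₐ pₐ |a⟩⟨a| ⊗ ρᵃ) = ∑ₐ pₐ |a⟩⟨a| ⊗ Γᵃ(ρᵃ)` with CPTP maps `Γᵃ`. -/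
def IsControlled {α β γ : Type} [Fintype α] [DecidableEq α] [Fintype β] [DecidableEq β]
    [Fintype γ] (Γ : Op (α × β) →ₗ[ℂ] Op (α × γ)) : Prop :=
  IsCPTP Γ ∧ ∃ G : α → (Op β →ₗ[ℂ] Op γ), (∀ a, IsCPTP (G a)) ∧
    ∀ (p : α → ℝ) (ρ : α → Op β), IsProb p → (∀ a, IsDensity (ρ a)) →
      Γ (cqOp p ρ) = cqOp p fun a => G a (ρ a)

/-- The case of `IsControlled` in which the input consists of the classical system alone:
`Γ : L(α) → L(α ⊗ γ)` with `Γ (∑ₐ pₐ |a⟩⟨a|) = ∑ₐ pₐ |a⟩⟨a| ⊗ τᵃ` for density operators `τᵃ`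
(a CPTP map from a one-dimensional system is the choice of a density operator). -/
def IsControlledPrep {α γ : Type} [Fintype α] [DecidableEq α] [Fintype γ]
    (Γ : Op α →ₗ[ℂ] Op (α × γ)) : Prop :=
  IsCPTP Γ ∧ ∃ τ : α → Op γ, (∀ a, IsDensity (τ a)) ∧
    ∀ p : α → ℝ, IsProb p → Γ (∑ a, p a • ketbra a) = cqOp p τ

/-- `(Φ ⊗ id_γ)(M)`. -/
def tensorId {α β : Type} (γ : Type) (Φ : Op α →ₗ[ℂ] Op β) (M : Op (α × γ)) : Op (β × γ) :=
  Matrix.of fun i j => Φ (Matrix.of fun a a' => M (a, i.2) (a', j.2)) i.1 j.1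

/-- `(id_γ ⊗ Φ)(M)`. -/
def idTensor {α β : Type} (γ : Type) (Φ : Op α →ₗ[ℂ] Op β) (M : Op (γ × α)) : Op (γ × β) :=
  Matrix.of fun i j => Φ (Matrix.of fun a a' => M (i.1, a) (j.1, a')) i.2 j.2

/-- Handing the register `x` over: the systems `(a₀, a, x), b` regrouped as `(a₀, a), (b, x)`. -/
def handOver (α₀ α ξ β : Type) : (α₀ × α × ξ) × β ≃ (α₀ × α) × (β × ξ) where
  toFun s := ((s.1.1, s.1.2.1), (s.2, s.1.2.2))
  invFun t := ((t.1.1, t.1.2, t.2.2), t.2.1)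
  left_inv _ := rfl
  right_inv _ := rfl

/-- A two-party quantum protocol with `r = n + 1` rounds in which Alice's operations are
classically controlled by her input `A₀`, which is preserved.

In one-based numbering, `A k` is Alice's memory `A_{k+1}`, `X k` and `Y k` are the messages
`X_{k+1}` and `Y_{k+1}`, `B k` is Bob's input space `B_0` (for `k = 0`) or memory `B_k`, and `Bout`
is his last memory `B_r`. Likewise `Φ₁` is Alice's first operation, `Φ k` is her operation
`Φ_{k+2}`, `Ψ k` is Bob's operation `Ψ_{k+1}` and `Ψlast` is his last operation `Ψ_r`. Only
`A k`, `X k`, `B k` with `k ≤ n` and `Y k`, `Φ k`, `Ψ k` with `k < n` matter. -/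
structure Protocol (A₀ : Type) [Fintype A₀] [DecidableEq A₀] (n : ℕ) where
  A : ℕ → Type
  X : ℕ → Type
  Y : ℕ → Type
  B : ℕ → Type
  Bout : Type
  [fintypeA : ∀ k, Fintype (A k)]
  [fintypeX : ∀ k, Fintype (X k)]
  [fintypeY : ∀ k, Fintype (Y k)]
  [fintypeB : ∀ k, Fintype (B k)]
  [fintypeBout : Fintype Bout]
  [decEqA : ∀ k, DecidableEq (A k)]
  [decEqX : ∀ k, DecidableEq (X k)]
  [decEqY : ∀ k, DecidableEq (Y k)]
  [decEqB : ∀ k, DecidableEq (B k)]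
  [decEqBout : DecidableEq Bout]
  Φ₁ : Op A₀ →ₗ[ℂ] Op (A₀ × A 0 × X 0)
  Φ : ∀ k, Op (A₀ × A k × Y k) →ₗ[ℂ] Op (A₀ × A (k + 1) × X (k + 1))
  Ψ : ∀ k, Op (B k × X k) →ₗ[ℂ] Op (B (k + 1) × Y k)
  Ψlast : Op (B n × X n) →ₗ[ℂ] Op Bout
  controlled_Φ₁ : IsControlledPrep Φ₁
  controlled_Φ : ∀ k < n, IsControlled (Φ k)
  cptp_Ψ : ∀ k < n, IsCPTP (Ψ k)
  cptp_Ψlast : IsCPTP Ψlast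

attribute [instance] Protocol.fintypeA Protocol.fintypeX Protocol.fintypeY Protocol.fintypeB
  Protocol.fintypeBout Protocol.decEqA Protocol.decEqX Protocol.decEqY Protocol.decEqB
  Protocol.decEqBout

namespace Protocol

variable {A₀ : Type} [Fintype A₀] [DecidableEq A₀] {n : ℕ} (P : Protocol A₀ n)

/-- Qubits sent from Alice to Bob: `m_A = ∑_{i=1}^{r} log₂ d_{X_i}`. -/
def mA : ℝ := ∑ k ∈ Finset.range (n + 1), Real.logb 2 (Fintype.card (P.X k))

/-- Qubits sent from Bob to Alice: `m_B = ∑_{j=1}^{r-1} log₂ d_{Y_j}`. -/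
def mB : ℝ := ∑ k ∈ Finset.range n, Real.logb 2 (Fintype.card (P.Y k))

/-- The global state once Alice has applied her first `k + 1` operations and Bob his first `k`. -/
def stateAfter (ρ : Op (A₀ × P.B 0)) : ∀ k, Op ((A₀ × P.A k × P.X k) × P.B k)
  | 0 => tensorId (P.B 0) P.Φ₁ ρ
  | k + 1 =>
    tensorId (P.B (k + 1)) (P.Φ k)
      (Matrix.reindex (handOver A₀ (P.A k) (P.Y k) (P.B (k + 1))).symm
        (handOver A₀ (P.A k) (P.Y k) (P.B (k + 1))).symm
        (idTensor (A₀ × P.A k) (P.Ψ k)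
          (Matrix.reindex (handOver A₀ (P.A k) (P.X k) (P.B k))
            (handOver A₀ (P.A k) (P.X k) (P.B k)) (stateAfter ρ k))))

/-- The final state `σ_{A₀ A_r B_r}` of the protocol on input `ρ_{A₀ B₀}`. -/
def finalState (ρ : Op (A₀ × P.B 0)) : Op ((A₀ × P.A n) × P.Bout) :=
  idTensor (A₀ × P.A n) P.Ψlast
    (Matrix.reindex (handOver A₀ (P.A n) (P.X n) (P.B n))
      (handOver A₀ (P.A n) (P.X n) (P.B n)) (P.stateAfter ρ n))

end Protocol

/-- Partial trace over the middle system of `(α ⊗ γ) ⊗ β`. -/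
def traceMid {α β γ : Type} [Fintype γ] (M : Op ((α × γ) × β)) : Op (α × β) :=
  Matrix.of fun i j => ∑ c, M ((i.1, c), i.2) ((j.1, c), j.2)

/-- Conditional min-entropy `H_min(A|B)_ρ = - inf_σ inf {l ∈ ℝ : ρ_AB ≤ 2^l id_A ⊗ σ_B}`, with `σ`
ranging over the density operators on `B`. The infima are taken in the extended reals because the
inner set is empty for some `σ`. -/
def Hmin {α β : Type} [DecidableEq α] [Fintype β] (ρ : Op (α × β)) : EReal :=
  -(⨅ (σ : Op β) (_ : IsDensity σ),
    ⨅ (l : ℝ) (_ : (((2 : ℝ) ^ l) • ((1 : Op α) ⊗ₖ σ) - ρ).PosSemidef), (l : EReal))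

end QLeak

end

/-! A feasible pair `(σ, l)` for the initial min-entropy says exactly that every conditional state
satisfies `p a • τ a ≤ t • σ` with `t = 2 ^ l`. Controlled operations keep the global state block
diagonal in `A₀`, with blocks `Sᵃ` shared by Alice's memory and Bob. It suffices to dominate Bob's
marginals of all final blocks by one operator of trace at most `2 ^ (l + m)`. Two invariants,
followed through the rounds, give the two values of `m`.

`MarginalBound` follows a common bound on Bob's marginals. Local operations and messages to Alice do
not increase its trace. A register `ξ` received by Bob costs `d_ξ ^ 2`, by `T ≤ d_ξ • (tr_ξ T ⊗ 1)`.
This gives `2 * mA`.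

`LinkBound` factors the bound as a contraction of `Cᵃ` (Alice, depending on `a`) with `D` (Bob,
common to all `a`). Alice's operations act on `Cᵃ` only and Bob's on `D` only. A message is routed
through the shared factor by an unnormalised entangled pair of trace `d_ξ`, given to the receiver's
operator, so it costs only `d_ξ` in either direction. At the end `traceLeft_link_le` bounds Bob's
marginal by `tr Cᵃ • traceLeft D`. This gives `mA + mB`. -/

noncomputable section

namespace QLeak

open scoped MatrixOrder

/-! ### Partial traces, regrouping of tensor factors, and contraction of a shared factor -/

section Operations

variable {α β γ ξ η : Type}

/-- Partial trace over the left factor. -/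
def traceLeft [Fintype α] (M : Op (α × β)) : Op β :=
  Matrix.of fun i j => ∑ a, M (a, i) (a, j)

/-- Partial trace over the right factor. -/
def traceRight [Fintype β] (M : Op (α × β)) : Op α :=
  Matrix.of fun i j => ∑ b, M (i, b) (j, b)

/-- The register `ξ` moves from the left party to the right party. -/
def passRight (M : Op ((α × ξ) × β)) : Op (α × (β × ξ)) :=
  M.submatrix (fun t => ((t.1, t.2.2), t.2.1)) fun t => ((t.1, t.2.2), t.2.1)

/-- The register `ξ` moves from the right party to the left party. -/
def passLeft (M : Op (α × (β × ξ))) : Op ((α × ξ) × β) :=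
  M.submatrix (fun s => (s.1.1, (s.2, s.1.2))) fun s => (s.1.1, (s.2, s.1.2))

/-- The block-diagonal operator `∑ₐ |a⟩⟨a| ⊗ Sᵃ` on `(α ⊗ β) ⊗ γ`. -/
def blockOp [DecidableEq α] (S : α → Op (β × γ)) : Op ((α × β) × γ) :=
  Matrix.of fun i j => if i.1.1 = j.1.1 then S i.1.1 (i.1.2, i.2) (j.1.2, j.2) else 0

/-- Contraction of an operator on `α ⊗ η` with one on `η ⊗ β` along the shared factor `η`
(the link product, up to a transposition). -/
def link [Fintype η] (C : Op (α × η)) (D : Op (η × β)) : Op (α × β) :=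
  Matrix.of fun i j => ∑ h, ∑ h', C (i.1, h) (j.1, h') * D (h, i.2) (h', j.2)

/-- The unnormalised maximally entangled operator `∑ |xx⟩⟨yy|`. -/
def entangled (ξ : Type) [DecidableEq ξ] : Op (ξ × ξ) :=
  Matrix.of fun i j => (if i.1 = i.2 then 1 else 0) * (if j.1 = j.2 then 1 else 0)

theorem entangled_posSemidef [Fintype ξ] [DecidableEq ξ] : (entangled ξ).PosSemidef := by
  convert Matrix.posSemidef_vecMulVec_self_star
    (fun i : ξ × ξ => if i.1 = i.2 then (1 : ℂ) else 0) using 1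
  ext i j
  simp only [entangled, Matrix.of_apply, Matrix.vecMulVec_apply, Pi.star_apply]
  congr 1
  split_ifs <;> simp

theorem trace_entangled [Fintype ξ] [DecidableEq ξ] :
    (entangled ξ).trace = Fintype.card ξ := by
  simp [Matrix.trace, entangled, Fintype.sum_prod_type]

theorem le_iff_posSemidef {M N : Op α} : M ≤ N ↔ (N - M).PosSemidef :=
  Iff.rfl

theorem trace_traceLeft [Fintype α] [Fintype β] (M : Op (α × β)) :
    (traceLeft M).trace = M.trace := by
  simp only [Matrix.trace, Matrix.diag_apply, traceLeft, Matrix.of_apply, Fintype.sum_prod_type]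
  exact Finset.sum_comm

theorem trace_traceRight [Fintype α] [Fintype β] (M : Op (α × β)) :
    (traceRight M).trace = M.trace := by
  simp only [Matrix.trace, Matrix.diag_apply, traceRight, Matrix.of_apply, Fintype.sum_prod_type]

theorem traceLeft_sub [Fintype α] (M N : Op (α × β)) :
    traceLeft (M - N) = traceLeft M - traceLeft N := by
  ext i j
  simp [traceLeft]

theorem traceRight_sub [Fintype β] (M N : Op (α × β)) :
    traceRight (M - N) = traceRight M - traceRight N := by
  ext i j
  simp [traceRight]

theorem traceLeft_posSemidef [Fintype α] {M : Op (α × β)} (hM : M.PosSemidef) :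
    (traceLeft M).PosSemidef := by
  have h : traceLeft M = ∑ a, M.submatrix (fun b => (a, b)) fun b => (a, b) := by
    ext i j
    simp [traceLeft, Matrix.sum_apply]
  rw [h]
  exact Matrix.posSemidef_sum _ fun a _ => hM.submatrix _

theorem traceRight_posSemidef [Fintype β] {M : Op (α × β)} (hM : M.PosSemidef) :
    (traceRight M).PosSemidef := by
  have h : traceRight M = ∑ b, M.submatrix (fun a => (a, b)) fun a => (a, b) := by
    ext i j
    simp [traceRight, Matrix.sum_apply]
  rw [h]
  exact Matrix.posSemidef_sum _ fun a _ => hM.submatrix _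

theorem traceLeft_mono [Fintype α] {M N : Op (α × β)} (h : M ≤ N) :
    traceLeft M ≤ traceLeft N := by
  rw [le_iff_posSemidef] at h ⊢
  rw [← traceLeft_sub]
  exact traceLeft_posSemidef h

theorem traceRight_mono [Fintype β] {M N : Op (α × β)} (h : M ≤ N) :
    traceRight M ≤ traceRight N := by
  rw [le_iff_posSemidef] at h ⊢
  rw [← traceRight_sub]
  exact traceRight_posSemidef h

theorem traceRight_passRight [Fintype α] [Fintype ξ] (M : Op ((α × ξ) × β)) :
    traceRight (traceLeft (passRight M)) = traceLeft M := by
  ext i j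
  simp only [traceLeft, traceRight, passRight, Matrix.of_apply, Matrix.submatrix_apply,
    Fintype.sum_prod_type]
  exact Finset.sum_comm

theorem traceLeft_passLeft [Fintype α] [Fintype ξ] (M : Op (α × (β × ξ))) :
    traceLeft (passLeft M) = traceRight (traceLeft M) := by
  ext i j
  simp only [traceLeft, traceRight, passLeft, Matrix.of_apply, Matrix.submatrix_apply,
    Fintype.sum_prod_type]
  exact Finset.sum_comm

theorem passRight_mono {M N : Op ((α × ξ) × β)} (h : M ≤ N) : passRight M ≤ passRight N :=
  Matrix.PosSemidef.submatrix h _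

theorem passLeft_mono {M N : Op (α × (β × ξ))} (h : M ≤ N) : passLeft M ≤ passLeft N :=
  Matrix.PosSemidef.submatrix h _

/-- The contraction is the compression `⟨Ω| C ⊗ D |Ω⟩` with `Ω = ∑ |hh⟩`: `K` keeps the entries of
`C ⊗ D` whose two `η` indices agree, and `W` sums over them. -/
theorem link_posSemidef [Fintype α] [Fintype β] [Fintype η] {C : Op (α × η)} {D : Op (η × β)}
    (hC : C.PosSemidef) (hD : D.PosSemidef) : (link C D).PosSemidef := by
  classical
  set K : Op ((α × β) × η) :=
    (C ⊗ₖ D).submatrix (fun t => ((t.1.1, t.2), (t.2, t.1.2)))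
      fun t => ((t.1.1, t.2), (t.2, t.1.2)) with hK
  set W : Matrix ((α × β) × η) (α × β) ℂ := (1 : Op (α × β)).submatrix Prod.fst id with hW
  have h : link C D = W.conjTranspose * K * W := by
    ext i j
    simp only [link, Matrix.of_apply, Matrix.mul_apply, hW, hK, Matrix.conjTranspose_apply,
      Matrix.submatrix_apply, Matrix.one_apply, id, Matrix.kroneckerMap_apply]
    rw [Fintype.sum_prod_type, Finset.sum_eq_single j]
    · simp only [if_true, mul_one]
      rw [Finset.sum_comm]
      refine Finset.sum_congr rfl fun h' _ => ?_
      rw [Fintype.sum_prod_type, Finset.sum_eq_single i]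
      · simp
      · intro b _ hb
        simp [hb]
      · simp
    · intro b _ hb
      simp [hb]
    · simp
  rw [h]
  exact ((hC.kronecker hD).submatrix _).conjTranspose_mul_mul_same W

theorem link_sub_right [Fintype η] (C : Op (α × η)) (D D' : Op (η × β)) :
    link C (D - D') = link C D - link C D' := by
  ext i j
  simp [link, mul_sub, Finset.sum_sub_distrib]

theorem le_trace_smul_one [Fintype α] [DecidableEq α] {M : Op α} (hM : M.PosSemidef) :
    M ≤ M.trace • (1 : Op α) := by
  rw [le_iff_posSemidef]
  set U := hM.1.eigenvectorUnitary
  set D : Op α := Matrix.diagonal fun i => M.trace - (hM.1.eigenvalues i : ℂ) with hD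
  have h : M.trace • (1 : Op α) - M = (U : Op α) * D * (U : Op α).conjTranspose := by
    have hUU : (U : Op α) * (U : Op α).conjTranspose = 1 := by
      rw [← Matrix.star_eq_conjTranspose]
      exact Unitary.mul_star_self_of_mem U.2
    have hDD : D = M.trace • (1 : Op α) -
        Matrix.diagonal (RCLike.ofReal ∘ hM.1.eigenvalues) := by
      ext i j
      by_cases hij : i = j
      · subst hij
        simp [hD]
      · simp [hD, hij]
    rw [hDD, mul_sub, sub_mul]
    have hs := hM.1.spectral_theorem
    rw [Unitary.conjStarAlgAut_apply] at hs
    simp only [Matrix.mul_smul, Matrix.smul_mul, mul_one, hUU]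
    exact congrArg _ hs
  rw [h]
  refine Matrix.PosSemidef.mul_mul_conjTranspose_same ?_ _
  refine Matrix.PosSemidef.diagonal fun i => ?_
  simp only [Pi.zero_apply, sub_nonneg]
  rw [hM.1.trace_eq_sum_eigenvalues]
  exact Finset.single_le_sum (f := fun i => (hM.1.eigenvalues i : ℂ))
    (fun j _ => by simpa using hM.eigenvalues_nonneg j) (Finset.mem_univ i)

theorem traceLeft_link_le [Fintype α] [Fintype β] [Fintype η] {C : Op (α × η)} {D : Op (η × β)}
    (hC : C.PosSemidef) (hD : D.PosSemidef) :
    traceLeft (link C D) ≤ C.trace • traceLeft D := by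
  classical
  rw [le_iff_posSemidef]
  -- Tracing out `α` leaves a contraction of `traceLeft C` with `D`, where the left factor is
  -- trivial (`Unit`). Replacing `traceLeft C` by the larger `C.trace • 1` turns it into `C.trace •
  -- traceLeft D`.
  have h1 := (le_iff_posSemidef.1 (le_trace_smul_one (traceLeft_posSemidef hC))).submatrix
    (Prod.snd : Unit × η → η)
  have h2 := (link_posSemidef h1 hD).submatrix fun b : β => ((), b)
  refine (congrArg Matrix.PosSemidef ?_).mpr h2
  ext i j
  simp only [Matrix.sub_apply, Matrix.smul_apply, traceLeft, link, Matrix.of_apply,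
    Matrix.submatrix_apply, sub_mul, Finset.sum_sub_distrib, Matrix.one_apply, smul_eq_mul]
  congr 1
  · rw [← trace_traceLeft C, Finset.mul_sum]
    refine Finset.sum_congr rfl fun h _ => ?_
    rw [Finset.sum_eq_single h]
    · simp [traceLeft]
    · intro b _ hb
      simp [hb.symm]
    · simp
  · rw [Finset.sum_comm]
    refine Finset.sum_congr rfl fun h _ => ?_
    rw [Finset.sum_comm]
    refine Finset.sum_congr rfl fun h' _ => ?_
    rw [Finset.sum_mul]

/-- Contracting `T` with `entangled ξ` returns `T`, and contracting it with `1` returns `traceRight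
T ⊗ 1`; the claim is then `entangled ξ ≤ d_ξ • 1`. -/
theorem le_card_smul_traceRight_kronecker_one [Fintype β] [Fintype ξ] [DecidableEq ξ]
    {T : Op (β × ξ)} (hT : T.PosSemidef) :
    T ≤ (Fintype.card ξ : ℂ) • (traceRight T ⊗ₖ (1 : Op ξ)) := by
  have h1 := le_iff_posSemidef.1 (le_trace_smul_one (entangled_posSemidef (ξ := ξ)))
  have h2 := link_posSemidef hT h1
  rw [le_iff_posSemidef]
  refine (congrArg Matrix.PosSemidef ?_).mpr h2
  rw [link_sub_right, trace_entangled]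
  congr 1
  · ext i j
    simp only [link, traceRight, Matrix.of_apply, Matrix.smul_apply, Matrix.kroneckerMap_apply,
      Matrix.one_apply, Prod.mk.injEq, smul_eq_mul, Finset.sum_mul, Finset.mul_sum]
    refine Finset.sum_congr rfl fun h _ => ?_
    rw [Finset.sum_eq_single h]
    · by_cases hij : i.2 = j.2 <;> simp [hij, mul_comm]
    · intro b _ hb
      simp [hb.symm]
    · simp
  · ext i j
    simp [link, entangled]

/-- `D ⊗ ∑ |xx⟩⟨yy|`, with one copy of `ξ` in the shared factor and one on the right. -/
def giveRight (ξ : Type) [DecidableEq ξ] (D : Op (η × β)) : Op ((ξ × η) × (β × ξ)) :=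
  (entangled ξ ⊗ₖ D).submatrix (fun t => ((t.1.1, t.2.2), (t.1.2, t.2.1)))
    fun t => ((t.1.1, t.2.2), (t.1.2, t.2.1))

/-- `C ⊗ ∑ |xx⟩⟨yy|`, with one copy of `ξ` in the shared factor and one on the left. -/
def giveLeft (ξ : Type) [DecidableEq ξ] (C : Op (α × η)) : Op ((α × ξ) × (ξ × η)) :=
  (entangled ξ ⊗ₖ C).submatrix (fun t => ((t.1.2, t.2.1), (t.1.1, t.2.2)))
    fun t => ((t.1.2, t.2.1), (t.1.1, t.2.2))

theorem giveRight_posSemidef [Fintype ξ] [DecidableEq ξ] [Fintype η] [Fintype β]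
    {D : Op (η × β)} (hD : D.PosSemidef) : (giveRight ξ D).PosSemidef :=
  (entangled_posSemidef.kronecker hD).submatrix _

theorem giveLeft_posSemidef [Fintype ξ] [DecidableEq ξ] [Fintype η] [Fintype α]
    {C : Op (α × η)} (hC : C.PosSemidef) : (giveLeft ξ C).PosSemidef :=
  (entangled_posSemidef.kronecker hC).submatrix _

theorem trace_giveRight [Fintype ξ] [DecidableEq ξ] [Fintype η] [Fintype β] (D : Op (η × β)) :
    (giveRight ξ D).trace = Fintype.card ξ * D.trace := by
  simp [Matrix.trace, giveRight, entangled, Fintype.sum_prod_type]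

theorem trace_giveLeft [Fintype ξ] [DecidableEq ξ] [Fintype η] [Fintype α] (C : Op (α × η)) :
    (giveLeft ξ C).trace = Fintype.card ξ * C.trace := by
  simp [Matrix.trace, giveLeft, entangled, Fintype.sum_prod_type, Finset.mul_sum]

/-- The entangled pair acts as an identity wire: the factor `ξ` of `C` joins the shared factor and
re-emerges on the right. -/
theorem passRight_link [Fintype η] [Fintype ξ] [DecidableEq ξ] (C : Op ((α × ξ) × η))
    (D : Op (η × β)) :
    passRight (link C D) = link (C.submatrix (fun t : α × ξ × η => ((t.1, t.2.1), t.2.2))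
      fun t => ((t.1, t.2.1), t.2.2)) (giveRight ξ D) := by
  ext i j
  simp [passRight, link, giveRight, entangled, Fintype.sum_prod_type]

theorem passLeft_link [Fintype η] [Fintype ξ] [DecidableEq ξ] (C : Op (α × η))
    (D : Op (η × (β × ξ))) :
    passLeft (link C D) = link (giveLeft ξ C)
      (D.submatrix (fun t : (ξ × η) × β => (t.1.2, (t.2, t.1.1)))
        fun t => (t.1.2, (t.2, t.1.1))) := by
  ext i j
  simp [passLeft, link, giveLeft, entangled, Fintype.sum_prod_type]

end Operations

/-! ### Quantum operations on one factor -/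

section Channels

variable {α β γ ξ η : Type}

theorem IsCPTP.trace_map [Fintype α] [DecidableEq α] [Fintype β] {Φ : Op α →ₗ[ℂ] Op β}
    (hΦ : IsCPTP Φ) (M : Op α) : (Φ M).trace = M.trace := by
  obtain ⟨m, E, hE, h⟩ := hΦ
  rw [h, Matrix.trace_sum]
  simp only [fun k => Matrix.trace_mul_cycle (E k) M (E k).conjTranspose]
  rw [← Matrix.trace_sum, ← Finset.sum_mul, hE, one_mul]

theorem IsCPTP.nonempty [Fintype α] [DecidableEq α] [Fintype β] [Nonempty α]
    {Φ : Op α →ₗ[ℂ] Op β} (hΦ : IsCPTP Φ) : Nonempty β := by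
  by_contra hβ
  rw [not_nonempty_iff] at hβ
  have h := hΦ.trace_map 1
  rw [Matrix.trace_one, Matrix.trace, Fintype.sum_empty] at h
  exact Fintype.card_ne_zero (α := α) (by exact_mod_cast h.symm)

theorem IsCPTP.tensorId_posSemidef [Fintype α] [DecidableEq α] [Fintype β] [Fintype γ]
    {Φ : Op α →ₗ[ℂ] Op β} (hΦ : IsCPTP Φ) {M : Op (α × γ)} (hM : M.PosSemidef) :
    (tensorId γ Φ M).PosSemidef := by
  classical
  obtain ⟨m, E, -, h⟩ := hΦ
  have hk : tensorId γ Φ M =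
      ∑ k, (E k ⊗ₖ (1 : Op γ)) * M * (E k ⊗ₖ (1 : Op γ)).conjTranspose := by
    ext i j
    simp only [tensorId, Matrix.of_apply, h, Matrix.sum_apply]
    refine Finset.sum_congr rfl fun k _ => ?_
    simp [Matrix.mul_apply, Matrix.one_apply, Fintype.sum_prod_type, apply_ite]
  rw [hk]
  exact Matrix.posSemidef_sum _ fun k _ => hM.mul_mul_conjTranspose_same _

theorem IsCPTP.idTensor_posSemidef [Fintype α] [DecidableEq α] [Fintype β] [Fintype γ]
    {Φ : Op α →ₗ[ℂ] Op β} (hΦ : IsCPTP Φ) {M : Op (γ × α)} (hM : M.PosSemidef) :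
    (idTensor γ Φ M).PosSemidef :=
  (hΦ.tensorId_posSemidef (hM.submatrix Prod.swap)).submatrix Prod.swap

theorem tensorId_sub (Φ : Op α →ₗ[ℂ] Op β) (M N : Op (α × γ)) :
    tensorId γ Φ (M - N) = tensorId γ Φ M - tensorId γ Φ N := by
  ext i j
  exact congrFun₂ (map_sub Φ (Matrix.of fun a a' => M (a, i.2) (a', j.2))
    (Matrix.of fun a a' => N (a, i.2) (a', j.2))) i.1 j.1

theorem idTensor_sub (Φ : Op α →ₗ[ℂ] Op β) (M N : Op (γ × α)) :
    idTensor γ Φ (M - N) = idTensor γ Φ M - idTensor γ Φ N := by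
  ext i j
  exact congrFun₂ (map_sub Φ (Matrix.of fun a a' => M (i.1, a) (j.1, a'))
    (Matrix.of fun a a' => N (i.1, a) (j.1, a'))) i.2 j.2

theorem IsCPTP.tensorId_mono [Fintype α] [DecidableEq α] [Fintype β] [Fintype γ]
    {Φ : Op α →ₗ[ℂ] Op β} (hΦ : IsCPTP Φ) {M N : Op (α × γ)} (h : M ≤ N) :
    tensorId γ Φ M ≤ tensorId γ Φ N := by
  rw [le_iff_posSemidef] at h ⊢
  rw [← tensorId_sub]
  exact hΦ.tensorId_posSemidef h

theorem IsCPTP.idTensor_mono [Fintype α] [DecidableEq α] [Fintype β] [Fintype γ]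
    {Φ : Op α →ₗ[ℂ] Op β} (hΦ : IsCPTP Φ) {M N : Op (γ × α)} (h : M ≤ N) :
    idTensor γ Φ M ≤ idTensor γ Φ N := by
  rw [le_iff_posSemidef] at h ⊢
  rw [← idTensor_sub]
  exact hΦ.idTensor_posSemidef h

theorem IsCPTP.map_posSemidef [Fintype α] [DecidableEq α] [Fintype β]
    {Φ : Op α →ₗ[ℂ] Op β} (hΦ : IsCPTP Φ) {M : Op α} (hM : M.PosSemidef) :
    (Φ M).PosSemidef :=
  (hΦ.tensorId_posSemidef (γ := Unit) (hM.submatrix Prod.fst)).submatrix fun b => (b, ())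

theorem IsCPTP.map_mono [Fintype α] [DecidableEq α] [Fintype β]
    {Φ : Op α →ₗ[ℂ] Op β} (hΦ : IsCPTP Φ) {M N : Op α} (h : M ≤ N) : Φ M ≤ Φ N := by
  rw [le_iff_posSemidef] at h ⊢
  rw [← map_sub]
  exact hΦ.map_posSemidef h

theorem IsCPTP.traceLeft_tensorId [Fintype α] [DecidableEq α] [Fintype β]
    {Φ : Op α →ₗ[ℂ] Op β} (hΦ : IsCPTP Φ) (M : Op (α × γ)) :
    traceLeft (tensorId γ Φ M) = traceLeft M := by
  ext i j
  exact hΦ.trace_map (Matrix.of fun a a' => M (a, i) (a', j))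

theorem IsCPTP.trace_tensorId [Fintype α] [DecidableEq α] [Fintype β] [Fintype γ]
    {Φ : Op α →ₗ[ℂ] Op β} (hΦ : IsCPTP Φ) (M : Op (α × γ)) :
    (tensorId γ Φ M).trace = M.trace := by
  rw [← trace_traceLeft, hΦ.traceLeft_tensorId, trace_traceLeft]

theorem traceLeft_idTensor [Fintype γ] (Φ : Op α →ₗ[ℂ] Op β) (M : Op (γ × α)) :
    traceLeft (idTensor γ Φ M) = Φ (traceLeft M) := by
  have h : traceLeft M = ∑ c, Matrix.of fun a a' => M (c, a) (c, a') := by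
    ext i j
    simp [traceLeft, Matrix.sum_apply]
  rw [h, map_sum]
  ext i j
  simp [traceLeft, idTensor, Matrix.sum_apply]

theorem IsCPTP.trace_idTensor [Fintype α] [DecidableEq α] [Fintype β] [Fintype γ]
    {Φ : Op α →ₗ[ℂ] Op β} (hΦ : IsCPTP Φ) (M : Op (γ × α)) :
    (idTensor γ Φ M).trace = M.trace := by
  rw [← trace_traceLeft, traceLeft_idTensor, hΦ.trace_map, trace_traceLeft]

/-- Each slice of the contraction is a linear combination of slices of `C` with coefficients from
`D`, so linearity of `Φ` suffices. -/
theorem tensorId_link [Fintype η] (Φ : Op α →ₗ[ℂ] Op β) (C : Op (α × η)) (D : Op (η × γ)) :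
    tensorId γ Φ (link C D) = link (tensorId η Φ C) D := by
  ext i j
  have h : (Matrix.of fun a a' => link C D (a, i.2) (a', j.2)) =
      ∑ h, ∑ h', D (h, i.2) (h', j.2) • (Matrix.of fun a a' => C (a, h) (a', h') : Op α) := by
    ext a a'
    simp [link, Matrix.sum_apply, mul_comm]
  rw [tensorId, Matrix.of_apply, h]
  simp only [tensorId, Matrix.of_apply, map_sum, map_smul, link, Matrix.sum_apply,
    Matrix.smul_apply, smul_eq_mul, mul_comm]

theorem idTensor_link [Fintype η] (Φ : Op α →ₗ[ℂ] Op β) (C : Op (γ × η)) (D : Op (η × α)) :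
    idTensor γ Φ (link C D) = link C (idTensor η Φ D) := by
  ext i j
  have h : (Matrix.of fun a a' => link C D (i.1, a) (j.1, a')) =
      ∑ h, ∑ h', C (i.1, h) (j.1, h') • (Matrix.of fun a a' => D (h, a) (h', a') : Op α) := by
    ext a a'
    simp [link, Matrix.sum_apply]
  rw [idTensor, Matrix.of_apply, h]
  simp only [idTensor, Matrix.of_apply, map_sum, map_smul, link, Matrix.sum_apply,
    Matrix.smul_apply, smul_eq_mul]

end Channels

/-! ### Two bounds on the conditional states, and how communication changes them -/

section Bounds

variable {ι α β γ ξ : Type} [Fintype α] [Fintype β] [Fintype γ] [Fintype ξ]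

/-- All `Sⁱ` are bounded by contractions of operators on the left of trace `c` with one common
operator on the right of trace `d`. -/
def LinkBound (S : ι → Op (α × β)) (c d : ℝ) : Prop :=
  ∃ (η : Type) (_ : Fintype η) (C : ι → Op (α × η)) (D : Op (η × β)),
    D.PosSemidef ∧ D.trace = d ∧
      ∀ i, (C i).PosSemidef ∧ (C i).trace = c ∧ S i ≤ link (C i) D

/-- The right marginals of all `Sⁱ` are bounded by one common operator of trace `d`. -/
def MarginalBound (S : ι → Op (α × β)) (d : ℝ) : Prop :=
  ∃ E : Op β, E.PosSemidef ∧ E.trace = d ∧ ∀ i, traceLeft (S i) ≤ E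

theorem LinkBound.marginalBound {S : ι → Op (α × β)} {c d : ℝ} (hc : 0 ≤ c)
    (h : LinkBound S c d) : MarginalBound S (c * d) := by
  obtain ⟨η, _, C, D, hD, hDd, hC⟩ := h
  refine ⟨(c : ℂ) • traceLeft D, (traceLeft_posSemidef hD).smul (by exact_mod_cast hc), ?_,
    fun i => ?_⟩
  · rw [Matrix.trace_smul, trace_traceLeft, hDd]
    simp
  · obtain ⟨hCi, hCc, hS⟩ := hC i
    rw [← hCc]
    exact (traceLeft_mono hS).trans (traceLeft_link_le hCi hD)

theorem LinkBound.passRight {S : ι → Op ((α × ξ) × β)} {c d : ℝ} (h : LinkBound S c d) :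
    LinkBound (fun i => passRight (S i)) c (Fintype.card ξ * d) := by
  classical
  obtain ⟨η, _, C, D, hD, hDd, hC⟩ := h
  refine ⟨ξ × η, inferInstance, _, giveRight ξ D, giveRight_posSemidef hD, ?_, fun i =>
    ⟨(hC i).1.submatrix fun t : α × ξ × η => ((t.1, t.2.1), t.2.2), ?_, ?_⟩⟩
  · rw [trace_giveRight, hDd]
    push_cast
    rfl
  · rw [← (hC i).2.1]
    simp [Matrix.trace, Fintype.sum_prod_type]
  · rw [← passRight_link]
    exact passRight_mono (hC i).2.2

theorem LinkBound.passLeft {S : ι → Op (α × (β × ξ))} {c d : ℝ} (h : LinkBound S c d) :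
    LinkBound (fun i => passLeft (S i)) (Fintype.card ξ * c) d := by
  classical
  obtain ⟨η, _, C, D, hD, hDd, hC⟩ := h
  refine ⟨ξ × η, inferInstance, fun i => giveLeft ξ (C i), _,
    hD.submatrix fun t : (ξ × η) × β => (t.1.2, (t.2, t.1.1)), ?_, fun i =>
    ⟨giveLeft_posSemidef (hC i).1, ?_, ?_⟩⟩
  · rw [← hDd]
    simp only [Matrix.trace, Matrix.diag_apply, Matrix.submatrix_apply, Fintype.sum_prod_type]
    rw [Finset.sum_comm]
    exact Finset.sum_congr rfl fun _ _ => Finset.sum_comm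
  · rw [trace_giveLeft, (hC i).2.1]
    push_cast
    rfl
  · rw [← passLeft_link]
    exact passLeft_mono (hC i).2.2

theorem LinkBound.tensorId [DecidableEq α] {S : ι → Op (α × β)} {c d : ℝ}
    (h : LinkBound S c d) {G : ι → (Op α →ₗ[ℂ] Op γ)} (hG : ∀ i, IsCPTP (G i)) :
    LinkBound (fun i => tensorId β (G i) (S i)) c d := by
  obtain ⟨η, _, C, D, hD, hDd, hC⟩ := h
  refine ⟨η, inferInstance, fun i => QLeak.tensorId η (G i) (C i), D, hD, hDd, fun i =>
    ⟨(hG i).tensorId_posSemidef (hC i).1, ?_, ?_⟩⟩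
  · rw [(hG i).trace_tensorId, (hC i).2.1]
  · rw [← tensorId_link]
    exact (hG i).tensorId_mono (hC i).2.2

theorem LinkBound.idTensor [DecidableEq β] {S : ι → Op (α × β)} {c d : ℝ}
    (h : LinkBound S c d) {Ψ : Op β →ₗ[ℂ] Op γ} (hΨ : IsCPTP Ψ) :
    LinkBound (fun i => idTensor α Ψ (S i)) c d := by
  obtain ⟨η, _, C, D, hD, hDd, hC⟩ := h
  refine ⟨η, inferInstance, C, QLeak.idTensor η Ψ D, hΨ.idTensor_posSemidef hD, ?_, fun i =>
    ⟨(hC i).1, (hC i).2.1, ?_⟩⟩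
  · rw [hΨ.trace_idTensor, hDd]
  · rw [← idTensor_link]
    exact hΨ.idTensor_mono (hC i).2.2

/-- One factor `d_ξ` comes from the operator inequality, the other from the trace of `1` on `ξ`. -/
theorem MarginalBound.passRight {S : ι → Op ((α × ξ) × β)} {d : ℝ}
    (hS : ∀ i, (S i).PosSemidef) (h : MarginalBound S d) :
    MarginalBound (fun i => passRight (S i)) ((Fintype.card ξ : ℝ) ^ 2 * d) := by
  classical
  obtain ⟨E, hE, hEd, hSE⟩ := h
  refine ⟨(Fintype.card ξ : ℂ) • (E ⊗ₖ (1 : Op ξ)),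
    (hE.kronecker Matrix.PosSemidef.one).smul (Nat.cast_nonneg _), ?_, fun i => ?_⟩
  · rw [Matrix.trace_smul, Matrix.trace_kronecker, hEd, Matrix.trace_one]
    push_cast
    simp only [smul_eq_mul]
    ring
  · refine (le_card_smul_traceRight_kronecker_one
      (traceLeft_posSemidef ((hS i).submatrix _))).trans ?_
    change _ • (traceRight (traceLeft (QLeak.passRight (S i))) ⊗ₖ (1 : Op ξ)) ≤ _
    rw [traceRight_passRight]
    have h1 := le_iff_posSemidef.1 (hSE i)
    rw [le_iff_posSemidef, ← smul_sub]
    refine Matrix.PosSemidef.smul ?_ (Nat.cast_nonneg _)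
    refine (congrArg Matrix.PosSemidef ?_).mpr
      (h1.kronecker (Matrix.PosSemidef.one (n := ξ) (R := ℂ)))
    ext s t
    simp [sub_mul]

/-- For Bob's marginal, sending a register away is a partial trace; hence no `mB` in the bound `2 *
mA`. -/
theorem MarginalBound.passLeft {S : ι → Op (α × (β × ξ))} {d : ℝ} (h : MarginalBound S d) :
    MarginalBound (fun i => passLeft (S i)) d := by
  obtain ⟨E, hE, hEd, hSE⟩ := h
  refine ⟨traceRight E, traceRight_posSemidef hE, ?_, fun i => ?_⟩
  · rw [trace_traceRight, hEd]
  · rw [traceLeft_passLeft]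
    exact traceRight_mono (hSE i)

theorem MarginalBound.tensorId [DecidableEq α] {S : ι → Op (α × β)} {d : ℝ}
    (h : MarginalBound S d) {G : ι → (Op α →ₗ[ℂ] Op γ)} (hG : ∀ i, IsCPTP (G i)) :
    MarginalBound (fun i => tensorId β (G i) (S i)) d := by
  obtain ⟨E, hE, hEd, hSE⟩ := h
  refine ⟨E, hE, hEd, fun i => ?_⟩
  rw [(hG i).traceLeft_tensorId]
  exact hSE i

theorem MarginalBound.idTensor [DecidableEq β] {S : ι → Op (α × β)} {d : ℝ}
    (h : MarginalBound S d) {Ψ : Op β →ₗ[ℂ] Op γ} (hΨ : IsCPTP Ψ) :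
    MarginalBound (fun i => idTensor α Ψ (S i)) d := by
  obtain ⟨E, hE, hEd, hSE⟩ := h
  refine ⟨Ψ E, hΨ.map_posSemidef hE, ?_, fun i => ?_⟩
  · rw [hΨ.trace_map, hEd]
  · rw [traceLeft_idTensor]
    exact hΨ.map_mono (hSE i)

end Bounds

/-! ### Classically controlled operations act blockwise -/

section Controlled

variable {α β γ δ ξ : Type}

/-- Density operators span: nonzero positive operators can be normalised, and polarisation (`hpol`)
writes matrix units through rank-one positive ones. -/
theorem linearMap_eq_of_eq_on_density [Fintype β] {V : Type*} [AddCommGroup V] [Module ℂ V]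
    {f g : Op β →ₗ[ℂ] V} (h : ∀ ρ, IsDensity ρ → f ρ = g ρ) : f = g := by
  classical
  have hpos : ∀ M : Op β, M.PosSemidef → f M = g M := by
    intro M hM
    by_cases h0 : M.trace = 0
    · rw [hM.trace_eq_zero_iff.1 h0, map_zero, map_zero]
    · have hd : IsDensity (M.trace⁻¹ • M) :=
        ⟨hM.smul (inv_nonneg.2 hM.trace_nonneg), by simp [h0]⟩
      have h1 := h _ hd
      rw [map_smul, map_smul] at h1
      exact smul_right_injective V (inv_ne_zero h0) h1
  have hvec : ∀ v : β → ℂ, f (Matrix.vecMulVec v (star v)) = g (Matrix.vecMulVec v (star v)) :=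
    fun v => hpos _ (Matrix.posSemidef_vecMulVec_self_star v)
  have hpol : ∀ i j : β, (Matrix.single i j 1 : Op β) = (1 / 2 : ℂ) •
      (Matrix.vecMulVec (Pi.single i 1 + Pi.single j 1) (star (Pi.single i 1 + Pi.single j 1)) +
        Complex.I • Matrix.vecMulVec (Pi.single i 1 + Pi.single j Complex.I)
          (star (Pi.single i 1 + Pi.single j Complex.I)) -
        (1 + Complex.I) • (Matrix.vecMulVec (Pi.single i 1) (star (Pi.single i 1)) +
          Matrix.vecMulVec (Pi.single j 1) (star (Pi.single j 1)))) := by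
    intro i j
    have hsingle : ∀ (k l : β) (x y : ℂ), Matrix.vecMulVec (Pi.single k x) (Pi.single l y) =
        (x * y) • (Matrix.single k l 1 : Op β) := by
      intro k l x y
      ext s t
      simp only [Matrix.vecMulVec_apply, Matrix.smul_apply, Matrix.single_apply, Pi.single_apply]
      by_cases hs : k = s <;> by_cases ht : l = t <;>
        simp [hs, ht, eq_comm (b := k), eq_comm (b := l)]
    simp only [star_add, Matrix.add_vecMulVec, Matrix.vecMulVec_add, ← Pi.single_star, hsingle,
      star_one, Complex.star_def, Complex.conj_I]
    match_scalars <;> ring_nf <;> simp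
    ring
  refine LinearMap.ext fun M => ?_
  rw [Matrix.matrix_eq_sum_single M]
  simp only [map_sum]
  refine Finset.sum_congr rfl fun i _ => Finset.sum_congr rfl fun j _ => ?_
  have h1 : Matrix.single i j (M i j) = M i j • (Matrix.single i j 1 : Op β) := by
    simp [Matrix.smul_single]
  rw [h1, map_smul, map_smul, hpol i j]
  simp only [map_smul, map_sub, map_add, hvec]

theorem isProb_single [Fintype α] [DecidableEq α] (a : α) : IsProb (Pi.single a (1 : ℝ)) :=
  ⟨fun b => by by_cases h : b = a <;> simp [h], by simp⟩

theorem cqOp_single [Fintype α] [DecidableEq α] (a : α) (ρ : α → Op β) :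
    cqOp (Pi.single a (1 : ℝ)) ρ = ketbra a ⊗ₖ ρ a := by
  rw [cqOp, Finset.sum_eq_single a]
  · simp
  · intro b _ hb
    simp [hb]
  · simp

/-- Point-mass distributions isolate one `a`; spanning does the rest. Arbitrary `M` is needed
because slices of a block between different basis vectors of Bob's space need not be positive. -/
theorem map_ketbra_kronecker [Fintype α] [DecidableEq α] [Fintype β]
    {Γ : Op (α × β) →ₗ[ℂ] Op (α × γ)} {G : α → (Op β →ₗ[ℂ] Op γ)}
    (h : ∀ (p : α → ℝ) (ρ : α → Op β), IsProb p → (∀ a, IsDensity (ρ a)) →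
      Γ (cqOp p ρ) = cqOp p fun a => G a (ρ a)) (a : α) (M : Op β) :
    Γ (ketbra a ⊗ₖ M) = ketbra a ⊗ₖ G a M := by
  refine LinearMap.congr_fun (linearMap_eq_of_eq_on_density
    (f := Γ ∘ₗ Matrix.kroneckerBilinear (R := ℂ) (ketbra a))
    (g := Matrix.kroneckerBilinear (R := ℂ) (ketbra a) ∘ₗ G a) fun ρ hρ => ?_) M
  have h1 := h (Pi.single a 1) (fun _ => ρ) (isProb_single a) fun _ => hρ
  rw [cqOp_single, cqOp_single] at h1
  exact h1

theorem tensorId_blockOp [Fintype α] [DecidableEq α] {Γ : Op (α × β) →ₗ[ℂ] Op (α × γ)}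
    {G : α → (Op β →ₗ[ℂ] Op γ)}
    (h : ∀ (a : α) (M : Op β), Γ (ketbra a ⊗ₖ M) = ketbra a ⊗ₖ G a M) (S : α → Op (β × δ)) :
    tensorId δ Γ (blockOp S) = blockOp fun a => tensorId δ (G a) (S a) := by
  ext i j
  have h1 : (Matrix.of fun s s' => blockOp S (s, i.2) (s', j.2)) =
      ∑ a, ketbra a ⊗ₖ (Matrix.of fun s s' => S a (s, i.2) (s', j.2) : Op β) := by
    ext s s'
    simp only [blockOp, Matrix.of_apply, Matrix.sum_apply, Matrix.kroneckerMap_apply, ketbra,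
      Matrix.single_apply]
    rw [Finset.sum_eq_single s.1]
    · simp
    · intro b _ hb
      simp [hb]
    · simp
  rw [tensorId, Matrix.of_apply, h1]
  simp only [map_sum, h]
  simp only [Matrix.sum_apply, Matrix.kroneckerMap_apply, ketbra, Matrix.single_apply,
    blockOp, Matrix.of_apply, tensorId]
  rw [Finset.sum_eq_single i.1.1]
  · simp
  · intro b _ hb
    simp [hb]
  · simp

theorem idTensor_blockOp [DecidableEq α] (Ψ : Op γ →ₗ[ℂ] Op δ) (S : α → Op (β × γ)) :
    idTensor (α × β) Ψ (blockOp S) = blockOp fun a => idTensor β Ψ (S a) := by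
  ext i j
  simp only [idTensor, blockOp, Matrix.of_apply]
  split_ifs with h
  · rfl
  · exact congrFun₂ (map_zero Ψ) i.2 j.2

theorem reindex_handOver_blockOp [DecidableEq α] (S : α → Op ((β × ξ) × γ)) :
    Matrix.reindex (handOver α β ξ γ) (handOver α β ξ γ) (blockOp S) =
      blockOp fun a => passRight (S a) :=
  rfl

theorem reindex_handOver_symm_blockOp [DecidableEq α] (S : α → Op (β × (γ × ξ))) :
    Matrix.reindex (handOver α β ξ γ).symm (handOver α β ξ γ).symm (blockOp S) =
      blockOp fun a => passLeft (S a) :=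
  rfl

theorem tensorId_cqOp [Fintype α] [DecidableEq α] {Γ : Op α →ₗ[ℂ] Op (α × γ)} {τ : α → Op γ}
    (h : ∀ p : α → ℝ, IsProb p → Γ (∑ a, p a • ketbra a) = cqOp p τ)
    (p : α → ℝ) (ρ : α → Op δ) :
    tensorId δ Γ (cqOp p ρ) = blockOp fun a => τ a ⊗ₖ (p a • ρ a) := by
  have hΓ : ∀ a, Γ (ketbra a) = ketbra a ⊗ₖ τ a := by
    intro a
    have h1 := h (Pi.single a 1) (isProb_single a)
    rw [cqOp_single, Finset.sum_eq_single a] at h1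
    · simpa using h1
    · intro b _ hb
      simp [hb]
    · simp
  ext i j
  have h1 : (Matrix.of fun a a' => cqOp p ρ (a, i.2) (a', j.2)) =
      ∑ a, (p a • ρ a) i.2 j.2 • ketbra a := by
    ext a a'
    simp only [cqOp, Matrix.of_apply, Matrix.sum_apply, Matrix.smul_apply,
      Matrix.kroneckerMap_apply, smul_eq_mul, Complex.real_smul]
    exact Finset.sum_congr rfl fun _ _ => by ring
  rw [tensorId, Matrix.of_apply, h1]
  simp only [map_sum, map_smul, hΓ]
  simp only [Matrix.sum_apply, Matrix.smul_apply, Matrix.kroneckerMap_apply, ketbra,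
    Matrix.single_apply, blockOp, Matrix.of_apply]
  rw [Finset.sum_eq_single i.1.1]
  · by_cases hij : i.1.1 = j.1.1 <;> simp [hij, mul_comm]
  · intro b _ hb
    simp [hb]
  · simp

theorem traceMid_blockOp [Fintype α] [DecidableEq α] [Fintype γ] (S : α → Op (γ × β)) :
    traceMid (blockOp S) = ∑ a, ketbra a ⊗ₖ traceLeft (S a) := by
  ext i j
  simp only [traceMid, blockOp, Matrix.of_apply, Matrix.sum_apply, Matrix.kroneckerMap_apply,
    ketbra, Matrix.single_apply, traceLeft]
  rw [Finset.sum_eq_single (f := fun a => _ * _) i.1]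
  · by_cases hij : i.1 = j.1 <;> simp [hij]
  · intro b _ hb
    simp [hb]
  · simp

theorem ketbra_posSemidef [Fintype α] [DecidableEq α] (a : α) :
    (ketbra a : Op α).PosSemidef := by
  have h : (ketbra a : Op α) = Matrix.diagonal (Pi.single a 1) := by
    rw [ketbra, Matrix.diagonal_single]
  rw [h]
  refine Matrix.PosSemidef.diagonal fun b => ?_
  by_cases hb : b = a <;> simp [hb]

end Controlled

/-! ### From bounds on the blocks to the min-entropy -/

section Entropy

variable {α β γ : Type}

theorem IsDensity.nonempty [Fintype β] {σ : Op β} (hσ : IsDensity σ) : Nonempty β := by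
  by_contra hβ
  rw [not_nonempty_iff] at hβ
  have h := hσ.2
  simp [Matrix.trace] at h

theorem exists_isDensity_le [Fintype β] [Nonempty β] {E : Op β} (hE : E.PosSemidef) {d t : ℝ}
    (hd : E.trace = d) (ht : 0 < t) (hdt : d ≤ t) : ∃ ω : Op β, IsDensity ω ∧ E ≤ t • ω := by
  classical
  have hN : (0 : ℝ) < Fintype.card β := by exact_mod_cast Fintype.card_pos
  -- The missing trace `t - d` is filled up with a multiple of the identity.
  set s : ℝ := (t - d) / Fintype.card β with hs
  have hs0 : 0 ≤ s := div_nonneg (sub_nonneg.2 hdt) hN.le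
  have h1 : (s • (1 : Op β)).PosSemidef := Matrix.PosSemidef.one.smul hs0
  refine ⟨t⁻¹ • (E + s • 1), ⟨(hE.add h1).smul (inv_nonneg.2 ht.le), ?_⟩, ?_⟩
  · rw [Matrix.trace_smul, Matrix.trace_add, Matrix.trace_smul, hd, Matrix.trace_one]
    have h2 : t⁻¹ * (d + s * Fintype.card β) = 1 := by
      rw [hs]
      field_simp
      ring
    simp only [Complex.real_smul]
    exact_mod_cast h2
  · rw [smul_smul, mul_inv_cancel₀ ht.ne', one_smul, le_iff_posSemidef, add_sub_cancel_left]
    exact h1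

theorem MarginalBound.exists_posSemidef [Fintype α] [DecidableEq α] [Fintype β] [Fintype γ]
    [Nonempty β] {S : α → Op (γ × β)} {d t : ℝ} (h : MarginalBound S d) (ht : 0 < t)
    (hdt : d ≤ t) : ∃ ω : Op β, IsDensity ω ∧
      (t • ((1 : Op α) ⊗ₖ ω) - traceMid (blockOp S)).PosSemidef := by
  obtain ⟨E, hE, hEd, hS⟩ := h
  obtain ⟨ω, hω, hEω⟩ := exists_isDensity_le hE hEd ht hdt
  refine ⟨ω, hω, ?_⟩
  have h1 : t • ((1 : Op α) ⊗ₖ ω) - traceMid (blockOp S) =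
      ∑ a, ketbra a ⊗ₖ (t • ω - traceLeft (S a)) := by
    have h2 : (1 : Op α) = ∑ a, ketbra a := by
      simp [ketbra, ← Matrix.diagonal_single, ← Matrix.diagonal_one, Matrix.ext_iff.symm,
        Matrix.sum_apply, Matrix.diagonal_apply, Pi.single_apply]
    rw [traceMid_blockOp, h2]
    ext i j
    simp only [Matrix.sub_apply, Matrix.smul_apply, Matrix.kroneckerMap_apply, Matrix.sum_apply,
      Finset.sum_mul, Finset.smul_sum, mul_sub, Finset.sum_sub_distrib, mul_smul_comm]
  rw [h1]
  exact Matrix.posSemidef_sum _ fun a _ =>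
    (ketbra_posSemidef a).kronecker (le_iff_posSemidef.1 ((hS a).trans hEω))

theorem block_le_of_cqOp_le [Fintype α] [DecidableEq α] {p : α → ℝ} {τ : α → Op β} {σ : Op β}
    {t : ℝ} (h : (t • ((1 : Op α) ⊗ₖ σ) - cqOp p τ).PosSemidef) (a : α) :
    p a • τ a ≤ t • σ := by
  rw [le_iff_posSemidef]
  refine (congrArg Matrix.PosSemidef ?_).mpr (h.submatrix fun b => (a, b))
  ext i j
  simp only [Matrix.sub_apply, Matrix.smul_apply, Matrix.submatrix_apply, cqOp, Matrix.sum_apply,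
    Matrix.kroneckerMap_apply, Matrix.one_apply_eq, one_mul, ketbra, Matrix.single_apply]
  rw [Finset.sum_eq_single a]
  · simp
  · intro b _ hb
    simp [hb]
  · simp

/-- Only an inequality, since `Real.logb 2 0 = 0` makes an empty register contribute `1` on the
right. -/
theorem prod_card_le_two_rpow (s : Finset ℕ) (c : ℕ → ℕ) :
    ∏ k ∈ s, (c k : ℝ) ≤ 2 ^ ∑ k ∈ s, Real.logb 2 (c k) := by
  rw [Real.rpow_sum_of_pos two_pos]
  refine Finset.prod_le_prod (fun _ _ => Nat.cast_nonneg _) fun k _ => ?_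
  rcases Nat.eq_zero_or_pos (c k) with h | h
  · simp [h]
  · rw [Real.rpow_logb two_pos (by norm_num) (by exact_mod_cast h)]

/-- Every feasible exponent for `ρ` shifts by `m` to one for `ρ'`. The infima may be infinite, but
`m` is finite, which legitimises the rearrangements in `EReal`. -/
theorem Hmin_sub_le_Hmin {α' β' : Type} [DecidableEq α] [Fintype β] [DecidableEq α'] [Fintype β']
    {ρ : Op (α × β)} {ρ' : Op (α' × β')} {m : ℝ}
    (h : ∀ (σ : Op β) (l : ℝ), IsDensity σ →
      (((2 : ℝ) ^ l) • ((1 : Op α) ⊗ₖ σ) - ρ).PosSemidef →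
      ∃ ω : Op β', IsDensity ω ∧
        (((2 : ℝ) ^ (l + m)) • ((1 : Op α') ⊗ₖ ω) - ρ').PosSemidef) :
    Hmin ρ - (m : EReal) ≤ Hmin ρ' := by
  have h1 : (⨅ (σ : Op β') (_ : IsDensity σ),
      ⨅ (l : ℝ) (_ : (((2 : ℝ) ^ l) • ((1 : Op α') ⊗ₖ σ) - ρ').PosSemidef), (l : EReal)) - m ≤
      ⨅ (σ : Op β) (_ : IsDensity σ),
      ⨅ (l : ℝ) (_ : (((2 : ℝ) ^ l) • ((1 : Op α) ⊗ₖ σ) - ρ).PosSemidef), (l : EReal) := by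
    refine le_iInf₂ fun σ hσ => le_iInf₂ fun l hl => ?_
    obtain ⟨ω, hω, hle⟩ := h σ l hσ hl
    rw [EReal.sub_le_iff_le_add (Or.inl (EReal.coe_ne_bot _)) (Or.inl (EReal.coe_ne_top _)),
      ← EReal.coe_add]
    exact iInf₂_le_of_le ω hω (iInf₂_le_of_le (l + m) hle le_rfl)
  have h2 := EReal.neg_le_neg_iff.2 h1
  rw [EReal.neg_sub (Or.inr (EReal.coe_ne_bot _)) (Or.inr (EReal.coe_ne_top _))] at h2
  rw [EReal.sub_le_iff_le_add (Or.inl (EReal.coe_ne_bot _)) (Or.inl (EReal.coe_ne_top _))]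
  exact h2

end Entropy

/-! ### The protocol -/

namespace Protocol

variable {A₀ : Type} [Fintype A₀] [DecidableEq A₀] {n : ℕ} (P : Protocol A₀ n)

/-- A trace-preserving map cannot go from a nonzero space to the zero space. This makes `Bout`
nonempty, so that it carries a density operator. -/
theorem nonempty_registers [Nonempty A₀] [Nonempty (P.B 0)] :
    ∀ k ≤ n, Nonempty (P.A k) ∧ Nonempty (P.X k) ∧ Nonempty (P.B k)
  | 0, _ => by
    obtain ⟨_, a, x⟩ := P.controlled_Φ₁.1.nonempty
    exact ⟨⟨a⟩, ⟨x⟩, inferInstance⟩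
  | k + 1, hk => by
    obtain ⟨_, _, _⟩ := nonempty_registers k (by omega)
    obtain ⟨b, y⟩ := (P.cptp_Ψ k hk).nonempty
    have : Nonempty (P.Y k) := ⟨y⟩
    obtain ⟨_, a, x⟩ := (P.controlled_Φ k hk).1.nonempty
    exact ⟨⟨a⟩, ⟨x⟩, ⟨b⟩⟩

theorem nonempty_Bout [Nonempty A₀] [Nonempty (P.B 0)] : Nonempty P.Bout := by
  obtain ⟨_, _, _⟩ := P.nonempty_registers n le_rfl
  exact P.cptp_Ψlast.nonempty

/-- At stage `k` the message `X k` is prepared but still with Alice, so only `X j` and `Y j` with `j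
< k` are paid for; `X n` is charged in `exists_blocks_finalState`. Positivity of the blocks is
carried along for `MarginalBound.passRight`. -/
theorem exists_blocks_stateAfter {p : A₀ → ℝ} {τ : A₀ → Op (P.B 0)} {σ : Op (P.B 0)} {t : ℝ}
    (hp : IsProb p) (hτ : ∀ a, IsDensity (τ a)) (hσ : IsDensity σ) (ht : 0 ≤ t)
    (h : ∀ a, p a • τ a ≤ t • σ) :
    ∀ k ≤ n, ∃ S : A₀ → Op ((P.A k × P.X k) × P.B k),
      P.stateAfter (cqOp p τ) k = blockOp S ∧ (∀ a, (S a).PosSemidef) ∧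
      LinkBound S (∏ j ∈ Finset.range k, (Fintype.card (P.Y j) : ℝ))
        ((∏ j ∈ Finset.range k, (Fintype.card (P.X j) : ℝ)) * t) ∧
      MarginalBound S ((∏ j ∈ Finset.range k, (Fintype.card (P.X j) : ℝ)) ^ 2 * t)
  | 0, _ => by
    obtain ⟨-, θ, hθ, hΦ⟩ := P.controlled_Φ₁
    have htσ : (t • σ).PosSemidef := hσ.1.smul ht
    -- Before any communication the shared factor is trivial: `θ a` is on the left and `t • σ` on
    -- the right.
    have hlink : LinkBound (fun a => θ a ⊗ₖ (p a • τ a)) 1 t := by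
      refine ⟨Unit, inferInstance, fun a => (θ a).submatrix Prod.fst Prod.fst,
        (t • σ).submatrix Prod.snd Prod.snd, htσ.submatrix _, ?_, fun a =>
        ⟨(hθ a).1.submatrix _, ?_, ?_⟩⟩
      · have := hσ.2
        simp only [Matrix.trace, Matrix.diag_apply] at this
        simp [Matrix.trace, Fintype.sum_prod_type, ← Finset.mul_sum, this]
      · have := (hθ a).2
        simpa [Matrix.trace, Fintype.sum_prod_type] using this
      · have h1 := (hθ a).1.kronecker (le_iff_posSemidef.1 (h a))
        rw [le_iff_posSemidef]
        refine (congrArg Matrix.PosSemidef ?_).mpr h1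
        ext i j
        simp [link, mul_sub]
    refine ⟨fun a => θ a ⊗ₖ (p a • τ a), tensorId_cqOp hΦ p τ, fun a =>
      (hθ a).1.kronecker ((hτ a).1.smul (hp.1 a)), by simpa using hlink, ?_⟩
    simpa using hlink.marginalBound zero_le_one
  | k + 1, hk => by
    obtain ⟨S, hS, hpos, hL, hM⟩ := exists_blocks_stateAfter hp hτ hσ ht h k (by omega)
    obtain ⟨-, G, hG, hΦ⟩ := P.controlled_Φ k hk
    have hΨ := P.cptp_Ψ k hk
    refine ⟨fun a => tensorId _ (G a) (passLeft (idTensor _ (P.Ψ k) (passRight (S a)))), ?_,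
      fun a => ?_, ?_, ?_⟩
    · rw [stateAfter, hS, reindex_handOver_blockOp, idTensor_blockOp,
        reindex_handOver_symm_blockOp, tensorId_blockOp (map_ketbra_kronecker hΦ)]
    · exact (hG a).tensorId_posSemidef
        ((hΨ.idTensor_posSemidef ((hpos a).submatrix _)).submatrix _)
    · convert ((hL.passRight.idTensor hΨ).passLeft).tensorId hG using 1
      · rw [Finset.prod_range_succ, mul_comm]
      · rw [Finset.prod_range_succ]
        ring
    · convert (((hM.passRight hpos).idTensor hΨ).passLeft).tensorId hG using 1
      rw [Finset.prod_range_succ]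
      ring

theorem exists_blocks_finalState {p : A₀ → ℝ} {τ : A₀ → Op (P.B 0)} {σ : Op (P.B 0)} {t : ℝ}
    (hp : IsProb p) (hτ : ∀ a, IsDensity (τ a)) (hσ : IsDensity σ) (ht : 0 ≤ t)
    (h : ∀ a, p a • τ a ≤ t • σ) :
    ∃ S : A₀ → Op (P.A n × P.Bout), P.finalState (cqOp p τ) = blockOp S ∧
      MarginalBound S ((∏ j ∈ Finset.range n, (Fintype.card (P.Y j) : ℝ)) *
        ((∏ j ∈ Finset.range (n + 1), (Fintype.card (P.X j) : ℝ)) * t)) ∧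
      MarginalBound S ((∏ j ∈ Finset.range (n + 1), (Fintype.card (P.X j) : ℝ)) ^ 2 * t) := by
  obtain ⟨S, hS, hpos, hL, hM⟩ := P.exists_blocks_stateAfter hp hτ hσ ht h n le_rfl
  refine ⟨fun a => idTensor _ P.Ψlast (passRight (S a)), ?_, ?_, ?_⟩
  · rw [finalState, hS, reindex_handOver_blockOp, idTensor_blockOp]
  · convert (hL.passRight.idTensor P.cptp_Ψlast).marginalBound (by positivity) using 1
    rw [Finset.prod_range_succ]
    ring
  · convert (hM.passRight hpos).idTensor P.cptp_Ψlast using 1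
    rw [Finset.prod_range_succ]
    ring

end Protocol

end QLeak

end

theorem mainTheorem1 {A₀ : Type} [Fintype A₀] [DecidableEq A₀] (n : ℕ)
    (P : QLeak.Protocol A₀ n) (ρ : QLeak.Op (A₀ × P.B 0)) (hρ : QLeak.IsCQState ρ) :
    QLeak.Hmin (QLeak.traceMid (P.finalState ρ)) ≥
      QLeak.Hmin ρ - ((min (P.mA + P.mB) (2 * P.mA) : ℝ) : EReal) := by
  obtain ⟨p, τ, hp, hτ, rfl⟩ := hρ
  refine QLeak.Hmin_sub_le_Hmin fun σ l hσ hl => ?_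
  have ht : (0 : ℝ) < 2 ^ l := Real.rpow_pos_of_pos two_pos l
  obtain ⟨S, hS, hlink, hmarg⟩ := P.exists_blocks_finalState hp hτ hσ ht.le
    (QLeak.block_le_of_cqOp_le hl)
  have : Nonempty (P.B 0) := hσ.nonempty
  have : Nonempty A₀ := by
    by_contra hA
    rw [not_nonempty_iff] at hA
    simpa using hp.2
  have : Nonempty P.Bout := P.nonempty_Bout
  have hX : ∏ k ∈ Finset.range (n + 1), (Fintype.card (P.X k) : ℝ) ≤ 2 ^ P.mA :=
    QLeak.prod_card_le_two_rpow _ _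
  have hY : ∏ k ∈ Finset.range n, (Fintype.card (P.Y k) : ℝ) ≤ 2 ^ P.mB :=
    QLeak.prod_card_le_two_rpow _ _
  rw [hS]
  rcases min_choice (P.mA + P.mB) (2 * P.mA) with h | h <;> rw [h]
  · refine hlink.exists_posSemidef (Real.rpow_pos_of_pos two_pos _) ?_
    rw [Real.rpow_add two_pos, Real.rpow_add two_pos]
    calc _ ≤ (2 : ℝ) ^ P.mB * (2 ^ P.mA * 2 ^ l) := by gcongr
      _ = _ := by ring
  · refine hmarg.exists_posSemidef (Real.rpow_pos_of_pos two_pos _) ?_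
    rw [Real.rpow_add two_pos, two_mul, Real.rpow_add two_pos]
    calc _ ≤ ((2 : ℝ) ^ P.mA) ^ 2 * 2 ^ l := by gcongr
      _ = _ := by ring
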